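/- Let $B$ be a braid on $s\ge 2$ strands given by a Fourier parametrisation: let $\mathcal C$ be a finite set and, for each $C\in\mathcal C$, let $s_C\ge 1$ be an integer, with $\sum_C s_C=s$, and let $F_C(t)=\sum_{j=-N_C}^{N_C}a_{C,j}e^{ijt}$, $G_C(t)=\sum_{j=-M_C}^{M_C}b_{C,j}e^{ijt}$ be real trigonometric polynomials ($a_{C,-j}=\overline{a_{C,j}}$, $b_{C,-j}=\overline{b_{C,j}}$) such that the $s$ strands $$\left(F_C\left(\tfrac{t+2\pi j}{s_C}\right),\,G_C\left(\tfrac{t+2\pi j}{s_C}\right),\,t\right),\qquad t\in[0,2\pi],\ C\in\mathcal C,\ j=1,\dots,s_C,$$ are pairwise disjoint. Denote the strands by $(X_i(t),Y_i(t),t)$, $i=1,\dots,s$, and for $a,b>0$ put $$g_{a,b}(u,t)=\prod_{i=1}^s\bigl(u-aX_i(t)-b\,\mathrm{i}\,Y_i(t)\bigr).$$ Then for all $a,b>0$ there is a unique polynomial $f_{a,b}$ in $u,v,\overline v$, without monomials divisible by $v\overline v$, such that $f_{a,b}(u,e^{it})=g_{a,b}(u,t)$ for all $u\in\mathbb C$,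 $t\in\mathbb R$. Let $\deg f_{a,b}$ be its total degree in $u,v,\overline v$. Let $q_1,q_2\ge 0$ and $k$ be real numbers, and put $$P_{a,b,k}(u,r,t)=r^{2sk}\,g_{r^{q_1}a,\,r^{q_2}b}\!\left(\frac{u}{r^{2k}},t\right)\qquad(r>0).$$ (i) For all $a,b>0$ with $k\ge \deg f_{a,b}/(2s)$, the conditions $p_{a,b,k}(u,re^{it})=P_{a,b,k}(u,r,t)$ for $r>0$ and $p_{a,b,k}(u,0)=u^s$ give a well-defined and continuous map $p_{a,b,k}:\mathbb C^2\to\mathbb C$. (ii) There is $\varepsilon>0$ (depending on the parametrisation and on $q_1,q_2,k$) such that for all $a,b\in(0,\varepsilon)$ with $k\ge\deg f_{a,b}/(2s)$ the following holds. The map $p_{a,b,k}$, viewed as a map $\mathbb R^4\to\mathbb R^2$, has a weakly isolated singular point at the origin: it vanishes at the origin, its Jacobian there exists and is zero, and the origin has a neighbourhood in which it is the only point of $p_{a,b,k}^{-1}(0)$ where the Jacobian fails to exist or has rank less than two. Moreover, for every $\rho\in(0,1]$ the set $p_{a,b,k}^{-1}(0)\cap S^3_\rho$, where $S^3_\rho=\{(u,v)\in\mathbb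 C^2:|u|^2+|v|^2=\rho^2\}$, is ambient isotopic in $S^3_\rho$ to the closure of $B$, that is, to the image of $\{(X_i(t)+\mathrm{i}\,Y_i(t),e^{it}) : 1\le i\le s,\ t\in[0,2\pi]\}\subset\mathbb C\times S^1$ under the embedding $(z,w)\mapsto \rho\,(z,w)/\sqrt{1+|z|^2}$ of the open solid torus $\mathbb C\times S^1$ into $S^3_\rho$. -/

import Mathlib

noncomputable section

/-- The raw data of a Fourier parametrisation: for every `C` in a finite index set `𝒞` (the link
components of the closure) a number `strands C` of strands, and the coefficients of two
trigonometric polynomials of orders `N C` and `M C`. -/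
structure FourierData (𝒞 : Type*) where
  strands : 𝒞 → ℕ
  N : 𝒞 → ℕ
  M : 𝒞 → ℕ
  coeffA : 𝒞 → ℤ → ℂ
  coeffB : 𝒞 → ℤ → ℂ

namespace FourierData

variable {𝒞 : Type*} (D : FourierData 𝒞)

/-- `F_C(x) = ∑_{|j| ≤ N_C} a_{C,j} e^{ijx}`. The sum is real under the symmetry condition on the
coefficients that is part of `FourierBraid`, so taking the real part changes nothing there. -/
def F (C : 𝒞) (x : ℝ) : ℝ :=
  (∑ j ∈ Finset.Icc (-(D.N C : ℤ)) (D.N C : ℤ),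
    D.coeffA C j * Complex.exp (Complex.I * (j : ℂ) * (x : ℂ))).re

/-- `G_C(x) = ∑_{|j| ≤ M_C} b_{C,j} e^{ijx}` (real for the same reason as `F`). -/
def G (C : 𝒞) (x : ℝ) : ℝ :=
  (∑ j ∈ Finset.Icc (-(D.M C : ℤ)) (D.M C : ℤ),
    D.coeffB C j * Complex.exp (Complex.I * (j : ℂ) * (x : ℂ))).re

/-- The strands are indexed by pairs `(C, j)`; the value `j : Fin (strands C)` stands for the strand
number `j + 1 ∈ {1, …, s_C}` of the component `C`. -/
abbrev Strand : Type _ := Σ C : 𝒞, Fin (D.strands C)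

/-- The first coordinate `F_C((t + 2πj)/s_C)` of a strand at height `t`. -/
def X (i : D.Strand) (t : ℝ) : ℝ :=
  D.F i.1 ((t + 2 * Real.pi * ((i.2 : ℕ) + 1 : ℝ)) / (D.strands i.1 : ℝ))

/-- The second coordinate `G_C((t + 2πj)/s_C)` of a strand at height `t`. -/
def Y (i : D.Strand) (t : ℝ) : ℝ :=
  D.G i.1 ((t + 2 * Real.pi * ((i.2 : ℕ) + 1 : ℝ)) / (D.strands i.1 : ℝ))

end FourierData

/-- A Fourier-parametrised braid: real trigonometric polynomials whose strands
`(X_i(t), Y_i(t), t)`, `t ∈ [0, 2π]`, are pairwise disjoint. -/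
structure FourierBraid (𝒞 : Type*) extends FourierData 𝒞 where
  strands_pos : ∀ C, 0 < strands C
  coeffA_symm : ∀ C j, coeffA C (-j) = (starRingEnd ℂ) (coeffA C j)
  coeffB_symm : ∀ C j, coeffB C (-j) = (starRingEnd ℂ) (coeffB C j)
  disjoint : ∀ t ∈ Set.Icc (0 : ℝ) (2 * Real.pi), ∀ i i' : toFourierData.Strand, i ≠ i' →
    (toFourierData.X i t, toFourierData.Y i t) ≠ (toFourierData.X i' t, toFourierData.Y i' t)

/-- The round three-sphere of radius `ρ` about the origin of `ℂ² = ℝ⁴`. -/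
def sphereThree (ρ : ℝ) : Set (ℂ × ℂ) :=
  {w | ‖w.1‖ ^ 2 + ‖w.2‖ ^ 2 = ρ ^ 2}

/-- The standard embedding of the open solid torus `ℂ × S¹` into the three-sphere of radius `ρ`, by
central projection: `(z, e^{it}) ↦ ρ (z, e^{it}) / |(z, e^{it})|`. Its image is the complement of
the unknotted circle `v = 0`, the braid axis. -/
def solidTorusEmbedding (ρ : ℝ) (z : ℂ) (t : ℝ) : ℂ × ℂ :=
  (((ρ / Real.sqrt (1 + ‖z‖ ^ 2) : ℝ) : ℂ) * z,
    ((ρ / Real.sqrt (1 + ‖z‖ ^ 2) : ℝ) : ℂ) * Complex.exp (Complex.I * (t : ℂ)))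

theorem solidTorusEmbedding_mem (ρ : ℝ) (z : ℂ) (t : ℝ) :
    solidTorusEmbedding ρ z t ∈ sphereThree ρ := by
  have h1 : (0 : ℝ) < 1 + ‖z‖ ^ 2 := by positivity
  have h2 : ‖Complex.exp (Complex.I * (t : ℂ))‖ = 1 := by
    rw [mul_comm]; exact Complex.norm_exp_ofReal_mul_I t
  simp only [sphereThree, solidTorusEmbedding, Set.mem_ofPred_eq, norm_mul, h2, Complex.norm_real,
    mul_pow, Real.norm_eq_abs, sq_abs, div_pow, Real.sq_sqrt h1.le]
  field_simp
  ring

/-- Two subsets of a space are ambient isotopic if an isotopy of the whole space, starting at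
the identity, carries the first onto the second. -/
def AmbientIsotopic {S : Type*} [TopologicalSpace S] (L L' : Set S) : Prop :=
  ∃ H : unitInterval → (S ≃ₜ S),
    Continuous (fun w : unitInterval × S => H w.1 w.2) ∧
    (∀ x, H 0 x = x) ∧ (H 1 : S → S) '' L = L'

/-- `x` is a critical point of `f : ℝ⁴ → ℝ²`: the Jacobian has rank less than two at `x`. (Points of
non-differentiability count as critical, since `fderiv` is zero there.) -/
def IsCriticalPoint (f : ℂ × ℂ → ℂ) (x : ℂ × ℂ) : Prop :=
  Module.finrank ℝ (LinearMap.range (fderiv ℝ f x : ℂ × ℂ →ₗ[ℝ] ℂ)) < 2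

/-- `x` is a singular point of `f : ℝ⁴ → ℝ²`: `f` is differentiable at `x` with zero Jacobian. -/
def IsSingularPoint (f : ℂ × ℂ → ℂ) (x : ℂ × ℂ) : Prop :=
  DifferentiableAt ℝ f x ∧ fderiv ℝ f x = 0

/-- `x` is a weakly isolated singular point of `f`: a singular point in the vanishing set with an
`ε`-neighbourhood in which it is the only critical point that lies in the vanishing set. -/
def IsWeaklyIsolatedSingularPoint (f : ℂ × ℂ → ℂ) (x : ℂ × ℂ) : Prop :=
  IsSingularPoint f x ∧ f x = 0 ∧
    ∃ ε : ℝ, 0 < ε ∧ ∀ y : ℂ × ℂ, ‖y.1 - x.1‖ ^ 2 + ‖y.2 - x.2‖ ^ 2 < ε ^ 2 →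
      IsCriticalPoint f y → f y = 0 → y = x

namespace FourierBraid

variable {𝒞 : Type*} [Fintype 𝒞] (B : FourierBraid 𝒞)

/-- The total number `s` of strands. -/
def numStrands : ℕ := ∑ C, B.strands C

/-- `g_{a,b}(u,t) = ∏_j (u - a X_j(t) - b i Y_j(t))`. -/
def g (a b : ℝ) (u : ℂ) (t : ℝ) : ℂ :=
  ∏ i : B.Strand, (u - (a : ℂ) * (B.X i t : ℂ) - (b : ℂ) * Complex.I * (B.Y i t : ℂ))

/-- `f`, a polynomial in `u`, `v`, `conj v` (the variables `0`, `1`, `2`), is the semiholomorphic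
polynomial `f_{a,b}`: no monomial contains both `v` and `conj v`, and
`f(u, e^{it}) = g_{a,b}(u, t)`. -/
def IsSemiholomorphicPolynomial (a b : ℝ) (f : MvPolynomial (Fin 3) ℂ) : Prop :=
  (∀ m ∈ f.support, m 1 = 0 ∨ m 2 = 0) ∧
    ∀ (u : ℂ) (t : ℝ),
      MvPolynomial.eval ![u, Complex.exp (Complex.I * (t : ℂ)),
        (starRingEnd ℂ) (Complex.exp (Complex.I * (t : ℂ)))] f = B.g a b u t

/-- `P_{a,b,k}(u,r,t) = r^{2sk} g_{r^{q₁} a, r^{q₂} b}(u / r^{2k}, t)`, meant for `r > 0`. -/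
def P (q₁ q₂ k a b : ℝ) (u : ℂ) (r t : ℝ) : ℂ :=
  ((r ^ (2 * (B.numStrands : ℝ) * k) : ℝ) : ℂ) *
    B.g (r ^ q₁ * a) (r ^ q₂ * b) (u / ((r ^ (2 * k) : ℝ) : ℂ)) t

/-- `p_{a,b,k}(u, r e^{it}) = P_{a,b,k}(u,r,t)` for `r > 0`, and `p_{a,b,k}(u,0) = u^s`. -/
def p (q₁ q₂ k a b : ℝ) (w : ℂ × ℂ) : ℂ :=
  if w.2 = 0 then w.1 ^ B.numStrands else B.P q₁ q₂ k a b w.1 ‖w.2‖ (Complex.arg w.2)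

/-- The vanishing set of `p_{a,b,k}` on the three-sphere of radius `ρ`. -/
def nodalLink (q₁ q₂ k a b ρ : ℝ) : Set (sphereThree ρ) :=
  {x | B.p q₁ q₂ k a b (x : ℂ × ℂ) = 0}

/-- The closure of the braid, as a link in the three-sphere of radius `ρ`: the ends `t = 0` and
`t = 2π` are glued, and the resulting closed braid in the solid torus `ℂ × S¹` is placed into the
sphere by the standard embedding. -/
def closure (ρ : ℝ) : Set (sphereThree ρ) :=
  {x | ∃ (i : B.Strand) (t : ℝ), t ∈ Set.Icc 0 (2 * Real.pi) ∧
    x = ⟨solidTorusEmbedding ρ ⟨B.X i t, B.Y i t⟩ t, solidTorusEmbedding_mem ρ _ t⟩}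

end FourierBraid

end

/-! For `r > 0` the scaling in `P` turns `p` into the product over the strands of `u - root i r t`,
where the root has real part `r^(2k+q₁) a X_i(t)` and imaginary part `r^(2k+q₂) b Y_i(t)`. Setting
`v = 1` in `f_{a,b}` gives a monic polynomial of degree `s` in `u`, so `deg f_{a,b} ≥ s` and `2k ≥
1`; this is all that the bound on `k` is needed for. The roots are then `O(r)`, which gives
continuity and `|p(x)| = O(|x|^s)` at the origin, hence a zero Jacobian because `s ≥ 2`. Where `v ≠
0` the roots are distinct, so the derivative in `u` alone already has rank two on the zero set
(`not_isCriticalPoint`).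

For the link type, dividing the two parts of `u` by `a r^(2k+q₁-1)` and `b r^(2k+q₂-1)` moves each
root to `r (X_i + i Y_i)`, and central projection then yields the closed braid. A stretch by factors
that decrease in `|v|`, followed by central projection, is a homeomorphism of the sphere, and
interpolating the factors linearly to `1` gives the isotopy (`ambientIsotopic_of_sphereStretch`).
The scales `a`, `b` are absorbed whatever their size.

The `u`-coefficients of `g_{a,b}` are `2π`-periodic trigonometric polynomials in `t/L`, with `L` a
common multiple of the `s_C`; averaging over translates makes them trigonometric polynomials in `t`,
which gives `f_{a,b}`. It is unique by the linear independence of characters. -/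

noncomputable section

/-! ### Stretching homeomorphisms of the three-sphere -/

/-- The map that rescales the real and imaginary parts of `u` by factors that depend on `|v|`. -/
def stretch (A B : ℝ → ℝ) (w : ℂ × ℂ) : ℂ × ℂ :=
  (⟨A ‖w.2‖ * w.1.re, B ‖w.2‖ * w.1.im⟩, w.2)

/-- The Euclidean norm on `ℂ² = ℝ⁴`. -/
def euclideanNorm (w : ℂ × ℂ) : ℝ := √(‖w.1‖ ^ 2 + ‖w.2‖ ^ 2)

/-- The map `stretch`, followed by the central projection to the sphere of radius `ρ`. -/
def sphereStretch (ρ : ℝ) (A B : ℝ → ℝ) (w : ℂ × ℂ) : ℂ × ℂ :=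
  (ρ / euclideanNorm (stretch A B w)) • stretch A B w

theorem Complex.norm_sq_eq_re_im (z : ℂ) : ‖z‖ ^ 2 = z.re ^ 2 + z.im ^ 2 := by
  rw [Complex.sq_norm, Complex.normSq_apply]; ring

theorem euclideanNorm_sq (w : ℂ × ℂ) : euclideanNorm w ^ 2 = ‖w.1‖ ^ 2 + ‖w.2‖ ^ 2 :=
  Real.sq_sqrt (by positivity)

theorem euclideanNorm_smul (c : ℝ) (hc : 0 ≤ c) (w : ℂ × ℂ) :
    euclideanNorm (c • w) = c * euclideanNorm w := by
  have : ‖(c • w).1‖ ^ 2 + ‖(c • w).2‖ ^ 2 = c ^ 2 * (‖w.1‖ ^ 2 + ‖w.2‖ ^ 2) := by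
    simp only [Prod.smul_fst, Prod.smul_snd, norm_smul, Real.norm_eq_abs, mul_pow, sq_abs]; ring
  rw [euclideanNorm, this, Real.sqrt_mul (sq_nonneg c), Real.sqrt_sq hc, euclideanNorm]

theorem continuous_euclideanNorm : Continuous euclideanNorm := by
  unfold euclideanNorm; fun_prop

theorem mem_sphereThree_iff {ρ : ℝ} (hρ : 0 ≤ ρ) {w : ℂ × ℂ} :
    w ∈ sphereThree ρ ↔ euclideanNorm w = ρ := by
  rw [sphereThree, Set.mem_ofPred_eq, ← euclideanNorm_sq]
  exact sq_eq_sq₀ (Real.sqrt_nonneg _) hρ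

theorem stretch_ne_zero {A B : ℝ → ℝ} (hA : ∀ r, 0 < A r) (hB : ∀ r, 0 < B r) {w : ℂ × ℂ}
    (hw : w ≠ 0) : stretch A B w ≠ 0 := by
  intro h
  apply hw
  simp only [stretch, Prod.ext_iff, Complex.ext_iff, Prod.fst_zero, Prod.snd_zero,
    Complex.zero_re, Complex.zero_im, mul_eq_zero, (hA _).ne', (hB _).ne', false_or] at h ⊢
  exact h

theorem euclideanNorm_pos {w : ℂ × ℂ} (hw : w ≠ 0) : 0 < euclideanNorm w := by
  refine Real.sqrt_pos.2 ?_
  by_cases h : w.1 = 0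
  · have h2 : w.2 ≠ 0 := fun h2 => hw (Prod.ext h h2)
    have := norm_pos_iff.2 h2
    positivity
  · have := norm_pos_iff.2 h
    positivity

theorem ne_zero_of_mem_sphereThree {ρ : ℝ} (hρ : 0 < ρ) {w : ℂ × ℂ} (hw : w ∈ sphereThree ρ) :
    w ≠ 0 := by
  rintro rfl
  simp only [sphereThree, Set.mem_ofPred_eq, Prod.fst_zero, Prod.snd_zero, norm_zero] at hw
  have : 0 < ρ ^ 2 := by positivity
  linarith

theorem sphereStretch_mem {ρ : ℝ} (hρ : 0 < ρ) {A B : ℝ → ℝ} (hA : ∀ r, 0 < A r)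
    (hB : ∀ r, 0 < B r) {w : ℂ × ℂ} (hw : w ∈ sphereThree ρ) :
    sphereStretch ρ A B w ∈ sphereThree ρ := by
  have h := euclideanNorm_pos (stretch_ne_zero hA hB (ne_zero_of_mem_sphereThree hρ hw))
  rw [mem_sphereThree_iff hρ.le, sphereStretch, euclideanNorm_smul _ (by positivity)]
  field_simp

/-- This is where monotonicity enters. From `|v| = c|v'| ≥ |v'|` the factors at `w` are at most
those at `w'`, so the parts of `u` also grow by at least `c`. As both points have norm `ρ`, this
forces `c = 1`. -/
theorem eq_of_stretch_eq_smul {ρ : ℝ} (hρ : 0 < ρ) {A B : ℝ → ℝ} (hA : ∀ r, 0 < A r)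
    (hB : ∀ r, 0 < B r) (hA' : AntitoneOn A (Set.Ici 0)) (hB' : AntitoneOn B (Set.Ici 0))
    {w w' : ℂ × ℂ} (hw : w ∈ sphereThree ρ) (hw' : w' ∈ sphereThree ρ) {c : ℝ} (hc : 1 ≤ c)
    (h : stretch A B w = c • stretch A B w') : w = w' := by
  obtain ⟨u, v⟩ := w
  obtain ⟨u', v'⟩ := w'
  simp only [stretch, Prod.smul_mk, Prod.mk.injEq, Complex.ext_iff, Complex.smul_re,
    Complex.smul_im, smul_eq_mul] at h
  obtain ⟨⟨h1, h2⟩, h3⟩ := h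
  have hv : v = c • v' := by
    apply Complex.ext <;> simp [h3]
  have hr : ‖v‖ = c * ‖v'‖ := by rw [hv, norm_smul, Real.norm_of_nonneg (by linarith)]
  have hle : ‖v'‖ ≤ ‖v‖ := by rw [hr]; nlinarith [norm_nonneg v']
  have key : ∀ {a a' x x' : ℝ}, 0 < a → a ≤ a' → a * x = c * (a' * x') →
      c ^ 2 * x' ^ 2 ≤ x ^ 2 := by
    intro a a' x x' ha haa e
    have e2 : a ^ 2 * x ^ 2 = a' ^ 2 * (c ^ 2 * x' ^ 2) := by
      rw [← mul_pow, e]; ring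
    have h4 : a ^ 2 * (c ^ 2 * x' ^ 2) ≤ a' ^ 2 * (c ^ 2 * x' ^ 2) := by gcongr
    rw [← e2] at h4
    exact le_of_mul_le_mul_left h4 (by positivity)
  have k1 := key (hA _) (hA' (norm_nonneg v') (norm_nonneg v) hle) h1
  have k2 := key (hB _) (hB' (norm_nonneg v') (norm_nonneg v) hle) h2
  simp only [sphereThree, Set.mem_ofPred_eq, Complex.norm_sq_eq_re_im u,
    Complex.norm_sq_eq_re_im u'] at hw hw'
  have hc1 : c = 1 := by
    have h5 : c ^ 2 * ρ ^ 2 ≤ 1 * ρ ^ 2 := by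
      rw [hr, mul_pow] at hw
      linear_combination k1 + k2 + hw - c ^ 2 * hw'
    have h6 := le_of_mul_le_mul_right h5 (by positivity)
    nlinarith
  subst hc1
  rw [one_smul] at hv
  subst hv
  simp only [one_mul, mul_eq_mul_left_iff, (hA _).ne', (hB _).ne', or_false] at h1 h2
  rw [Complex.ext h1 h2]

theorem sphereStretch_injOn {ρ : ℝ} (hρ : 0 < ρ) {A B : ℝ → ℝ} (hA : ∀ r, 0 < A r)
    (hB : ∀ r, 0 < B r) (hA' : AntitoneOn A (Set.Ici 0)) (hB' : AntitoneOn B (Set.Ici 0)) :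
    Set.InjOn (sphereStretch ρ A B) (sphereThree ρ) := by
  intro w hw w' hw' h
  have n := euclideanNorm_pos (stretch_ne_zero hA hB (ne_zero_of_mem_sphereThree hρ hw))
  have n' := euclideanNorm_pos (stretch_ne_zero hA hB (ne_zero_of_mem_sphereThree hρ hw'))
  simp only [sphereStretch] at h
  set d := euclideanNorm (stretch A B w)
  set d' := euclideanNorm (stretch A B w')
  have e : stretch A B w = (d / d') • stretch A B w' := by
    have := congrArg (fun x => (d / ρ) • x) h
    simp only [smul_smul] at this
    rw [show d / ρ * (ρ / d) = 1 by field_simp, one_smul,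
      show d / ρ * (ρ / d') = d / d' by field_simp] at this
    exact this
  have e' : stretch A B w' = (d' / d) • stretch A B w := by
    rw [e, smul_smul, show d' / d * (d / d') = 1 by field_simp, one_smul]
  rcases le_total d' d with hd | hd
  · exact eq_of_stretch_eq_smul hρ hA hB hA' hB' hw hw' ((one_le_div n').2 hd) e
  · exact (eq_of_stretch_eq_smul hρ hA hB hA' hB' hw' hw ((one_le_div n).2 hd) e').symm

/-- Intermediate value argument along the ray through `y`: `f l` is the squared norm of the preimage
of `l • y` under `stretch`, and some `l` makes it `ρ ^ 2`. -/
theorem sphereStretch_surjOn {ρ : ℝ} (hρ : 0 < ρ) {A B : ℝ → ℝ} (hA : ∀ r, 0 < A r)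
    (hB : ∀ r, 0 < B r) (hA' : AntitoneOn A (Set.Ici 0)) (hB' : AntitoneOn B (Set.Ici 0))
    (cA : Continuous A) (cB : Continuous B) :
    Set.SurjOn (sphereStretch ρ A B) (sphereThree ρ) (sphereThree ρ) := by
  intro y hy
  have hy2 := hy
  simp only [sphereThree, Set.mem_ofPred_eq, Complex.norm_sq_eq_re_im y.1] at hy
  let f : ℝ → ℝ := fun l => (l * y.1.re / A (l * ‖y.2‖)) ^ 2 + (l * y.1.im / B (l * ‖y.2‖)) ^ 2
    + (l * ‖y.2‖) ^ 2
  have hf : Continuous f := by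
    have h1 : ∀ l, A (l * ‖y.2‖) ≠ 0 := fun l => (hA _).ne'
    have h2 : ∀ l, B (l * ‖y.2‖) ≠ 0 := fun l => (hB _).ne'
    simp only [f]
    fun_prop (disch := assumption)
  -- Antitone factors are at most `M`, so no coordinate of the preimage of `M • y` is smaller in
  -- size than that of `y`.
  set M := max 1 (max (A 0) (B 0)) with hM
  have hM1 : 1 ≤ M := le_max_left _ _
  have key : ∀ {a x : ℝ}, 0 < a → a ≤ M → x ^ 2 ≤ (M * x / a) ^ 2 := by
    intro a x ha hx
    rw [mul_div_right_comm, mul_pow]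
    have : 1 ≤ M / a := (one_le_div ha).2 hx
    nlinarith [sq_nonneg x, mul_le_mul this this zero_le_one (by linarith)]
  have hMv : 0 ≤ M * ‖y.2‖ := by positivity
  have hfM : ρ ^ 2 ≤ f M := by
    have k1 := key (x := y.1.re) (hA (M * ‖y.2‖))
      ((hA' (Set.mem_Ici.2 le_rfl) hMv hMv).trans ((le_max_left _ _).trans (le_max_right _ _)))
    have k2 := key (x := y.1.im) (hB (M * ‖y.2‖))
      ((hB' (Set.mem_Ici.2 le_rfl) hMv hMv).trans ((le_max_right _ _).trans (le_max_right _ _)))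
    have k3 := key (x := ‖y.2‖) one_pos hM1
    rw [div_one] at k3
    simp only [f]
    linarith
  have hf0 : f 0 ≤ ρ ^ 2 := by simp [f]; positivity
  obtain ⟨l, hl, hfl⟩ := intermediate_value_Icc (by linarith : (0 : ℝ) ≤ M) hf.continuousOn
    ⟨hf0, hfM⟩
  have hl0 : 0 < l := by
    rcases hl.1.eq_or_lt with h | h
    · rw [← h] at hfl
      have : 0 < ρ ^ 2 := by positivity
      simp only [f, zero_mul, zero_div] at hfl
      linarith
    · exact h
  have hn : ‖(l : ℂ) * y.2‖ = l * ‖y.2‖ := by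
    rw [norm_mul, Complex.norm_real, Real.norm_of_nonneg hl0.le]
  refine ⟨(⟨l * y.1.re / A (l * ‖y.2‖), l * y.1.im / B (l * ‖y.2‖)⟩, l * y.2), ?_, ?_⟩
  · simp only [sphereThree, Set.mem_ofPred_eq, hn]
    rw [Complex.norm_sq_eq_re_im]
    exact hfl
  · have e : stretch A B (⟨l * y.1.re / A (l * ‖y.2‖), l * y.1.im / B (l * ‖y.2‖)⟩, l * y.2)
        = l • y := by
      have h1 := (hA (l * ‖y.2‖)).ne'
      have h2 := (hB (l * ‖y.2‖)).ne'
      simp only [stretch, hn]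
      refine Prod.ext (Complex.ext ?_ ?_) ?_
      · simp; field_simp
      · simp; field_simp
      · simp
    rw [sphereStretch, e, euclideanNorm_smul _ hl0.le, (mem_sphereThree_iff hρ.le).1 hy2, smul_smul,
      show ρ / (l * ρ) * l = 1 by field_simp, one_smul]

theorem isCompact_sphereThree (ρ : ℝ) : IsCompact (sphereThree ρ) := by
  refine Metric.isCompact_of_isClosed_isBounded ?_ ?_
  · exact isClosed_eq (by fun_prop) continuous_const
  · refine (Metric.isBounded_iff_subset_closedBall 0).2 ⟨|ρ|, fun w hw => ?_⟩
    simp only [sphereThree, Set.mem_ofPred_eq] at hw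
    rw [mem_closedBall_zero_iff, Prod.norm_def, max_le_iff]
    constructor <;> refine abs_le_of_sq_le_sq' ?_ (abs_nonneg _) |>.2 <;> rw [sq_abs] <;>
      nlinarith [sq_nonneg ‖w.1‖, sq_nonneg ‖w.2‖]

instance sphereThree.instCompactSpace (ρ : ℝ) : CompactSpace (sphereThree ρ) :=
  isCompact_iff_compactSpace.1 (isCompact_sphereThree ρ)

/-- The self-homeomorphism of the sphere of radius `ρ` given by `sphereStretch`. -/
def sphereStretchHomeo {ρ : ℝ} (hρ : 0 < ρ) {A B : ℝ → ℝ} (hA : ∀ r, 0 < A r)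
    (hB : ∀ r, 0 < B r) (hA' : AntitoneOn A (Set.Ici 0)) (hB' : AntitoneOn B (Set.Ici 0))
    (cA : Continuous A) (cB : Continuous B) : sphereThree ρ ≃ₜ sphereThree ρ :=
  Continuous.homeoOfEquivCompactToT2
    (f := Equiv.ofBijective
      (fun x : sphereThree ρ =>
        (⟨sphereStretch ρ A B x, sphereStretch_mem hρ hA hB x.2⟩ : sphereThree ρ))
      ⟨fun x y h => Subtype.ext (sphereStretch_injOn hρ hA hB hA' hB' x.2 y.2
          (congrArg Subtype.val h)),
        fun y => by
          obtain ⟨x, hx, h⟩ := sphereStretch_surjOn hρ hA hB hA' hB' cA cB y.2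
          exact ⟨⟨x, hx⟩, Subtype.ext h⟩⟩)
    (by
      refine Continuous.subtype_mk ?_ _
      have h : ∀ x : sphereThree ρ, euclideanNorm (stretch A B x) ≠ 0 := fun x =>
        (euclideanNorm_pos (stretch_ne_zero hA hB (ne_zero_of_mem_sphereThree hρ x.2))).ne'
      have hs : Continuous fun x : sphereThree ρ => stretch A B x := by
        simp only [stretch, Complex.mk_eq_add_mul_I]
        fun_prop
      exact (continuous_const.div (continuous_euclideanNorm.comp hs) h).smul hs)

theorem sphereStretchHomeo_apply {ρ : ℝ} (hρ : 0 < ρ) {A B : ℝ → ℝ} (hA : ∀ r, 0 < A r)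
    (hB : ∀ r, 0 < B r) (hA' : AntitoneOn A (Set.Ici 0)) (hB' : AntitoneOn B (Set.Ici 0))
    (cA : Continuous A) (cB : Continuous B) (x : sphereThree ρ) :
    (sphereStretchHomeo hρ hA hB hA' hB' cA cB x : ℂ × ℂ) = sphereStretch ρ A B x := rfl

/-- Positivity, monotonicity and continuity of the factors survive convex combination with the
constant `1`, so every stage of the linear interpolation is again a homeomorphism. -/
theorem ambientIsotopic_of_sphereStretch {ρ : ℝ} (hρ : 0 < ρ) {A B : ℝ → ℝ} (hA : ∀ r, 0 < A r)
    (hB : ∀ r, 0 < B r) (hA' : AntitoneOn A (Set.Ici 0)) (hB' : AntitoneOn B (Set.Ici 0))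
    (cA : Continuous A) (cB : Continuous B) {L L' : Set (sphereThree ρ)}
    (h : ∀ x y : sphereThree ρ, sphereStretch ρ A B x = y → (x ∈ L ↔ y ∈ L')) :
    AmbientIsotopic L L' := by
  let I (A : ℝ → ℝ) (s : unitInterval) (r : ℝ) : ℝ := (1 - s) + s * A r
  have pos : ∀ {A : ℝ → ℝ}, (∀ r, 0 < A r) → ∀ s r, 0 < I A s r := by
    intro A hA s r
    have h0 := s.2.1
    have h1 := s.2.2
    rcases h1.eq_or_lt with e | e
    · simp only [I, e]; linarith [hA r]
    · exact add_pos_of_pos_of_nonneg (by linarith) (mul_nonneg h0 (hA r).le)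
  have anti : ∀ {A : ℝ → ℝ}, AntitoneOn A (Set.Ici 0) → ∀ s, AntitoneOn (I A s) (Set.Ici 0) := by
    intro A hA s x hx y hy hxy
    exact add_le_add_right (mul_le_mul_of_nonneg_left (hA hx hy hxy) s.2.1) _
  have cont : ∀ {A : ℝ → ℝ}, Continuous A → ∀ s, Continuous (I A s) := by
    intro A cA s
    simp only [I]
    fun_prop
  refine ⟨fun s => sphereStretchHomeo hρ (pos hA s) (pos hB s) (anti hA' s) (anti hB' s)
    (cont cA s) (cont cB s), ?_, ?_, ?_⟩
  · refine continuous_induced_rng.2 ?_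
    have hne : ∀ w : unitInterval × sphereThree ρ,
        euclideanNorm (stretch (I A w.1) (I B w.1) w.2) ≠ 0 := fun w =>
      (euclideanNorm_pos (stretch_ne_zero (pos hA _) (pos hB _)
        (ne_zero_of_mem_sphereThree hρ w.2.2))).ne'
    have hs : Continuous fun w : unitInterval × sphereThree ρ =>
        stretch (I A w.1) (I B w.1) w.2 := by
      simp only [stretch, Complex.mk_eq_add_mul_I, I]
      fun_prop
    exact (continuous_const.div (continuous_euclideanNorm.comp hs) hne).smul hs
  · intro x
    apply Subtype.ext
    have e : stretch (I A 0) (I B 0) x = (x : ℂ × ℂ) := by simp [stretch, I]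
    rw [sphereStretchHomeo_apply, sphereStretch, e, (mem_sphereThree_iff hρ.le).1 x.2,
      div_self hρ.ne', one_smul]
  · have e : ∀ A : ℝ → ℝ, I A 1 = A := fun A => by funext r; simp [I]
    ext y
    constructor
    · rintro ⟨x, hx, rfl⟩
      refine (h x _ ?_).1 hx
      rw [sphereStretchHomeo_apply, e, e]
    · intro hy
      obtain ⟨x, hx⟩ := (sphereStretchHomeo hρ (pos hA 1) (pos hB 1) (anti hA' 1) (anti hB' 1)
        (cont cA 1) (cont cB 1)).surjective y
      refine ⟨x, (h x y ?_).2 hy, hx⟩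
      rw [← hx, sphereStretchHomeo_apply, e, e]

/-! ### Periodicity, bounds and smoothness of the strands -/

theorem Fin.prod_succ_eq_of_eq {M : Type*} [CommMonoid M] {n : ℕ} (φ : ℕ → M) (h : φ n = φ 0) :
    ∏ j : Fin n, φ (j + 1) = ∏ j : Fin n, φ j := by
  rw [Fin.prod_univ_eq_prod_range (fun j => φ (j + 1)), Fin.prod_univ_eq_prod_range φ]
  cases n with
  | zero => rfl
  | succ m => rw [Finset.prod_range_succ, Finset.prod_range_succ', h]

namespace FourierData

variable {𝒞 : Type*} (D : FourierData 𝒞)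

theorem exp_int_mul_add_two_pi (j : ℤ) (x : ℝ) :
    Complex.exp (Complex.I * j * ((x + 2 * Real.pi : ℝ) : ℂ)) =
      Complex.exp (Complex.I * j * (x : ℂ)) := by
  rw [← (Complex.exp_periodic.int_mul j) (Complex.I * j * (x : ℂ))]
  congr 1
  push_cast
  ring

theorem F_periodic (C : 𝒞) : Function.Periodic (D.F C) (2 * Real.pi) := fun x => by
  simp only [F, exp_int_mul_add_two_pi]

theorem G_periodic (C : 𝒞) : Function.Periodic (D.G C) (2 * Real.pi) := fun x => by
  simp only [G, exp_int_mul_add_two_pi]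

theorem norm_exp_I_mul_int_mul (j : ℤ) (x : ℝ) : ‖Complex.exp (Complex.I * j * (x : ℂ))‖ = 1 := by
  rw [show Complex.I * j * (x : ℂ) = ((j * x : ℝ) : ℂ) * Complex.I by push_cast; ring,
    Complex.norm_exp_ofReal_mul_I]

theorem abs_F_le (C : 𝒞) (x : ℝ) :
    |D.F C x| ≤ ∑ j ∈ Finset.Icc (-(D.N C : ℤ)) (D.N C : ℤ), ‖D.coeffA C j‖ := by
  refine (Complex.abs_re_le_norm _).trans (norm_sum_le_of_le _ fun j _ => ?_)
  rw [norm_mul, norm_exp_I_mul_int_mul, mul_one]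

theorem abs_G_le (C : 𝒞) (x : ℝ) :
    |D.G C x| ≤ ∑ j ∈ Finset.Icc (-(D.M C : ℤ)) (D.M C : ℤ), ‖D.coeffB C j‖ := by
  refine (Complex.abs_re_le_norm _).trans (norm_sum_le_of_le _ fun j _ => ?_)
  rw [norm_mul, norm_exp_I_mul_int_mul, mul_one]

theorem exists_bound [Fintype 𝒞] :
    ∃ R : ℝ, 0 ≤ R ∧ ∀ (i : D.Strand) (t : ℝ), |D.X i t| ≤ R ∧ |D.Y i t| ≤ R := by
  refine ⟨(∑ C, ∑ j ∈ Finset.Icc (-(D.N C : ℤ)) (D.N C : ℤ), ‖D.coeffA C j‖) +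
    ∑ C, ∑ j ∈ Finset.Icc (-(D.M C : ℤ)) (D.M C : ℤ), ‖D.coeffB C j‖, by positivity,
    fun i t => ?_⟩
  have h1 := Finset.single_le_sum (f := fun C => ∑ j ∈ Finset.Icc (-(D.N C : ℤ)) (D.N C : ℤ),
    ‖D.coeffA C j‖) (fun C _ => by positivity) (Finset.mem_univ i.1)
  have h2 := Finset.single_le_sum (f := fun C => ∑ j ∈ Finset.Icc (-(D.M C : ℤ)) (D.M C : ℤ),
    ‖D.coeffB C j‖) (fun C _ => by positivity) (Finset.mem_univ i.1)
  constructor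
  · refine (D.abs_F_le _ _).trans (h1.trans (le_add_of_nonneg_right (by positivity)))
  · refine (D.abs_G_le _ _).trans (h2.trans (le_add_of_nonneg_left (by positivity)))

theorem differentiable_F (C : 𝒞) : Differentiable ℝ (D.F C) := by
  have h : Differentiable ℝ fun x : ℝ => ∑ j ∈ Finset.Icc (-(D.N C : ℤ)) (D.N C : ℤ),
      D.coeffA C j * Complex.exp (Complex.I * (j : ℂ) * (x : ℂ)) := by
    have : Differentiable ℝ fun x : ℝ => (x : ℂ) := Complex.ofRealCLM.differentiable
    fun_prop
  exact Complex.reCLM.differentiable.comp h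

theorem differentiable_G (C : 𝒞) : Differentiable ℝ (D.G C) := by
  have h : Differentiable ℝ fun x : ℝ => ∑ j ∈ Finset.Icc (-(D.M C : ℤ)) (D.M C : ℤ),
      D.coeffB C j * Complex.exp (Complex.I * (j : ℂ) * (x : ℂ)) := by
    have : Differentiable ℝ fun x : ℝ => (x : ℂ) := Complex.ofRealCLM.differentiable
    fun_prop
  exact Complex.reCLM.differentiable.comp h

theorem differentiable_X (i : D.Strand) : Differentiable ℝ (D.X i) := by
  have := D.differentiable_F i.1
  unfold X
  fun_prop

theorem differentiable_Y (i : D.Strand) : Differentiable ℝ (D.Y i) := by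
  have := D.differentiable_G i.1
  unfold Y
  fun_prop

end FourierData

namespace FourierBraid

variable {𝒞 : Type*} [Fintype 𝒞] (B : FourierBraid 𝒞)

theorem card_strand : Fintype.card B.Strand = B.numStrands := by
  simp [numStrands, Fintype.card_sigma]

/-- Products over all strands of a function of the strand positions are `2π`-periodic. -/
theorem prod_strand_add_two_pi {M : Type*} [CommMonoid M] (φ : ℝ → ℝ → M) (t : ℝ) :
    ∏ i : B.Strand, φ (B.X i (t + 2 * Real.pi)) (B.Y i (t + 2 * Real.pi)) =
      ∏ i : B.Strand, φ (B.X i t) (B.Y i t) := by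
  rw [Fintype.prod_sigma, Fintype.prod_sigma]
  refine Finset.prod_congr rfl fun C _ => ?_
  let arg (j : ℕ) : ℝ := (t + 2 * Real.pi * (j + 1 : ℝ)) / (B.strands C : ℝ)
  let ψ (j : ℕ) : M := φ (B.F C (arg j)) (B.G C (arg j))
  have hC : (B.strands C : ℝ) ≠ 0 := by exact_mod_cast (B.strands_pos C).ne'
  -- Adding `2π` to `t` moves strand `j` to strand `j + 1`; the last one wraps around by the period
  -- of `F` and `G`.
  have e0 : arg (B.strands C) = arg 0 + 2 * Real.pi := by
    simp only [arg]; field_simp; push_cast; ring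
  have h : ψ (B.strands C) = ψ 0 := by
    simp only [ψ, e0, B.F_periodic C _, B.G_periodic C _]
  have e : ∀ j : ℕ, (t + 2 * Real.pi + 2 * Real.pi * (j + 1 : ℝ)) / (B.strands C : ℝ) =
      arg (j + 1) := by
    intro j; simp only [arg]; push_cast; ring
  have := Fin.prod_succ_eq_of_eq ψ h
  simpa only [ψ, FourierData.X, FourierData.Y, e] using this

theorem g_periodic (a b : ℝ) (u : ℂ) : Function.Periodic (B.g a b u) (2 * Real.pi) := fun t =>
  B.prod_strand_add_two_pi (fun x y => u - (a : ℂ) * (x : ℂ) - (b : ℂ) * Complex.I * (y : ℂ)) t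

end FourierBraid

/-- The strands are assumed disjoint only for `t` in `[0, 2π]`, so the angle is wanted there and not
in `(-π, π]`. -/
theorem Complex.exists_angle (v : ℂ) :
    ∃ t ∈ Set.Icc (0 : ℝ) (2 * Real.pi), v = (‖v‖ : ℂ) * Complex.exp (Complex.I * (t : ℂ)) := by
  have h : v = (‖v‖ : ℂ) * Complex.exp (Complex.I * (v.arg : ℂ)) := by
    rw [mul_comm Complex.I]; exact (Complex.norm_mul_exp_arg_mul_I v).symm
  rcases le_or_gt 0 v.arg with h0 | h0
  · exact ⟨v.arg, ⟨h0, by linarith [Complex.arg_le_pi v, Real.pi_pos]⟩, h⟩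
  · refine ⟨v.arg + 2 * Real.pi, ⟨by linarith [Complex.neg_pi_lt_arg v, Real.pi_pos],
      by linarith⟩, ?_⟩
    rw [show Complex.I * ((v.arg + 2 * Real.pi : ℝ) : ℂ) = Complex.I * (v.arg : ℂ) +
      2 * Real.pi * Complex.I by push_cast; ring, Complex.exp_periodic]
    exact h

/-! ### Factorisation of `p` and its singularity at the origin -/

namespace FourierBraid

variable {𝒞 : Type*} [Fintype 𝒞] (B : FourierBraid 𝒞)

/-- The root of `P_{a,b,k}(·, r, t)` that belongs to a strand. -/
def root (q₁ q₂ k a b : ℝ) (i : B.Strand) (r t : ℝ) : ℂ :=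
  ⟨r ^ (2 * k + q₁) * (a * B.X i t), r ^ (2 * k + q₂) * (b * B.Y i t)⟩

variable {q₁ q₂ k a b : ℝ}

theorem P_eq_prod (u : ℂ) {r : ℝ} (hr : 0 < r) (t : ℝ) :
    B.P q₁ q₂ k a b u r t = ∏ i, (u - B.root q₁ q₂ k a b i r t) := by
  have h : ((r ^ (2 * (B.numStrands : ℝ) * k) : ℝ) : ℂ) =
      ∏ _i : B.Strand, ((r ^ (2 * k) : ℝ) : ℂ) := by
    rw [Finset.prod_const, Finset.card_univ, card_strand, ← Complex.ofReal_pow,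
      ← Real.rpow_mul_natCast hr.le]
    congr 2
    ring
  rw [P, g, h, ← Finset.prod_mul_distrib]
  refine Finset.prod_congr rfl fun i _ => ?_
  have h0 : ((r ^ (2 * k) : ℝ) : ℂ) ≠ 0 := by exact_mod_cast (Real.rpow_pos_of_pos hr _).ne'
  rw [root, Real.rpow_add hr, Real.rpow_add hr, Complex.mk_eq_add_mul_I]
  field_simp
  push_cast
  ring

theorem p_mul_exp (u : ℂ) {r : ℝ} (t : ℝ) (hr : 0 < r) :
    B.p q₁ q₂ k a b (u, (r : ℂ) * Complex.exp (Complex.I * (t : ℂ))) =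
      B.P q₁ q₂ k a b u r t := by
  set v := (r : ℂ) * Complex.exp (Complex.I * (t : ℂ)) with hv
  have hr' : (r : ℂ) ≠ 0 := by exact_mod_cast hr.ne'
  have hv0 : v ≠ 0 := mul_ne_zero hr' (Complex.exp_ne_zero _)
  have hn : ‖v‖ = r := by
    rw [hv, mul_comm Complex.I, norm_mul, Complex.norm_exp_ofReal_mul_I, Complex.norm_real,
      Real.norm_of_nonneg hr.le, mul_one]
  have he : Complex.exp (v.arg * Complex.I) = Complex.exp (t * Complex.I) := by
    have := Complex.norm_mul_exp_arg_mul_I v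
    rw [hn] at this
    rw [mul_comm (t : ℂ)]
    exact mul_left_cancel₀ hr' this
  obtain ⟨n, hn'⟩ := Complex.exp_eq_exp_iff_exists_int.1 he
  have ht : v.arg = t + n * (2 * Real.pi) := by
    have h2 : (v.arg : ℂ) * Complex.I = ((t + n * (2 * Real.pi) : ℝ) : ℂ) * Complex.I := by
      rw [hn']; push_cast; ring
    exact_mod_cast mul_right_cancel₀ Complex.I_ne_zero h2
  rw [p, if_neg hv0, hn, ht, P, P, ((B.g_periodic _ _ _).int_mul n) t]

/-- The exponents are positive, so at `r = 0` all roots vanish and the product is `u^s`. -/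
theorem p_eq_prod (hk : 0 < 2 * k) (hq₁ : 0 ≤ q₁) (hq₂ : 0 ≤ q₂) (w : ℂ × ℂ) :
    B.p q₁ q₂ k a b w = ∏ i, (w.1 - B.root q₁ q₂ k a b i ‖w.2‖ (Complex.arg w.2)) := by
  by_cases h : w.2 = 0
  · have e : ∀ i t, B.root q₁ q₂ k a b i 0 t = 0 := by
      intro i t
      rw [root, Real.zero_rpow (by linarith), Real.zero_rpow (by linarith), zero_mul, zero_mul]
      rfl
    simp only [p, h, if_true, norm_zero, e, sub_zero, Finset.prod_const, Finset.card_univ,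
      card_strand]
  · rw [p, if_neg h, P_eq_prod B _ (norm_pos_iff.2 h)]

theorem exists_norm_root_le (hk : 1 ≤ 2 * k) (hq₁ : 0 ≤ q₁) (hq₂ : 0 ≤ q₂) :
    ∃ R : ℝ, 0 ≤ R ∧ ∀ i r t, 0 ≤ r → r ≤ 1 → ‖B.root q₁ q₂ k a b i r t‖ ≤ R * r := by
  obtain ⟨R, hR, hb⟩ := B.exists_bound
  refine ⟨|a| * R + |b| * R, by positivity, fun i r t hr hr1 => ?_⟩
  have key : ∀ e c x : ℝ, 1 ≤ e → |x| ≤ R → |r ^ e * (c * x)| ≤ r * (|c| * R) := by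
    intro e c x he hx
    rw [abs_mul, abs_mul, abs_of_nonneg (Real.rpow_nonneg hr e)]
    have : r ^ e ≤ r := by
      simpa using Real.rpow_le_rpow_of_exponent_ge_of_imp hr hr1 he (fun _ h => by linarith)
    gcongr
  have h1 := key (2 * k + q₁) a _ (by linarith) (hb i t).1
  have h2 := key (2 * k + q₂) b _ (by linarith) (hb i t).2
  refine (Complex.norm_le_abs_re_add_abs_im _).trans ((add_le_add h1 h2).trans_eq ?_)
  ring

theorem differentiableAt_p {w : ℂ × ℂ} (hw : w.2 ≠ 0) :
    DifferentiableAt ℝ (B.p q₁ q₂ k a b) w := by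
  classical
  -- A branch of the angle that is smooth near `w`, even where `arg` jumps; by periodicity `p` may
  -- be computed with it.
  let T (x : ℂ × ℂ) : ℝ := w.2.arg + (Complex.log (x.2 / w.2)).im
  have hT : DifferentiableAt ℝ T w := by
    have h1 : DifferentiableAt ℝ (fun x : ℂ × ℂ => x.2 / w.2) w := by fun_prop
    have h2 : DifferentiableAt ℝ Complex.log (w.2 / w.2) := by
      rw [div_self hw]
      exact (Complex.differentiableAt_log Complex.one_mem_slitPlane).restrictScalars ℝ
    have h3 := h2.comp w h1
    exact DifferentiableAt.const_add w.2.arg (f := fun x : ℂ × ℂ => (Complex.log (x.2 / w.2)).im)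
      (Complex.imCLM.differentiableAt.comp w h3)
  have hN : DifferentiableAt ℝ (fun x : ℂ × ℂ => ‖x.2‖) w := differentiableAt_snd.norm ℝ hw
  have hroot : ∀ i, DifferentiableAt ℝ (fun x : ℂ × ℂ => B.root q₁ q₂ k a b i ‖x.2‖ (T x)) w := by
    intro i
    have hX := ((B.differentiable_X i).differentiableAt (x := T w)).comp w hT
    have hY := ((B.differentiable_Y i).differentiableAt (x := T w)).comp w hT
    have hp : ∀ e : ℝ, DifferentiableAt ℝ (fun x : ℂ × ℂ => ‖x.2‖ ^ e) w := fun e =>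
      hN.rpow_const (Or.inl (norm_ne_zero_iff.2 hw))
    have h1 := (hp (2 * k + q₁)).mul (hX.const_mul a)
    have h2 := (hp (2 * k + q₂)).mul (hY.const_mul b)
    simp only [root, Complex.mk_eq_add_mul_I]
    exact (Complex.ofRealCLM.differentiableAt.comp w h1).add
      ((Complex.ofRealCLM.differentiableAt.comp w h2).mul_const Complex.I)
  have hd : DifferentiableAt ℝ
      (fun x : ℂ × ℂ => ∏ i, (x.1 - B.root q₁ q₂ k a b i ‖x.2‖ (T x))) w :=
    (HasFDerivAt.finsetProd fun i _ =>
      (differentiableAt_fst.sub (hroot i)).hasFDerivAt).differentiableAt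
  refine hd.congr_of_eventuallyEq ?_
  filter_upwards [continuousAt_snd.eventually_ne hw] with x hx
  rw [← P_eq_prod B _ (norm_pos_iff.2 hx), ← p_mul_exp B _ _ (norm_pos_iff.2 hx)]
  refine congrArg _ (Prod.ext rfl ?_)
  have e1 := Complex.norm_mul_exp_arg_mul_I w.2
  have e2 := Complex.norm_mul_exp_arg_mul_I (x.2 / w.2)
  have hn : (‖w.2‖ : ℂ) ≠ 0 := by exact_mod_cast norm_ne_zero_iff.2 hw
  rw [norm_div, Complex.ofReal_div] at e2
  calc x.2 = w.2 * (x.2 / w.2) := by field_simp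
    _ = (‖w.2‖ * Complex.exp (w.2.arg * Complex.I)) *
        (‖x.2‖ / ‖w.2‖ * Complex.exp ((x.2 / w.2).arg * Complex.I)) := by rw [e1, e2]
    _ = _ := by
      rw [show Complex.I * (T x : ℂ) = w.2.arg * Complex.I + (x.2 / w.2).arg * Complex.I by
        simp only [T, Complex.log_im]; push_cast; ring, Complex.exp_add]
      field_simp

theorem continuous_p (hk : 1 ≤ 2 * k) (hq₁ : 0 ≤ q₁) (hq₂ : 0 ≤ q₂) :
    Continuous (B.p q₁ q₂ k a b) := by
  refine continuous_iff_continuousAt.2 fun w => ?_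
  by_cases hw : w.2 = 0
  · obtain ⟨R, hR, hb⟩ := B.exists_norm_root_le (a := a) (b := b) hk hq₁ hq₂
    have hN : Filter.Tendsto (fun x : ℂ × ℂ => ‖x.2‖) (nhds w) (nhds 0) := by
      have : ContinuousAt (fun x : ℂ × ℂ => ‖x.2‖) w := by fun_prop
      simpa [ContinuousAt, hw] using this
    have hroot : ∀ i, Filter.Tendsto
        (fun x : ℂ × ℂ => B.root q₁ q₂ k a b i ‖x.2‖ x.2.arg) (nhds w) (nhds 0) := by
      intro i
      refine squeeze_zero_norm' ?_ (by simpa using hN.const_mul R)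
      filter_upwards [hN.eventually (gt_mem_nhds one_pos)] with x hx
      exact hb i _ _ (norm_nonneg _) hx.le
    have h := tendsto_finsetProd Finset.univ fun i (_ : i ∈ Finset.univ) =>
      ((continuous_fst : Continuous (Prod.fst : ℂ × ℂ → ℂ)).tendsto w).sub (hroot i)
    have e : ∀ x, B.p q₁ q₂ k a b x = _ := B.p_eq_prod (by linarith) hq₁ hq₂
    rw [ContinuousAt, show B.p q₁ q₂ k a b w = ∏ i : B.Strand, (w.1 - 0) by
      simp only [p, hw, if_true, sub_zero, Finset.prod_const, Finset.card_univ, card_strand]]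
    exact h.congr fun x => (e x).symm
  · exact (B.differentiableAt_p hw).continuousAt

/-- Each of the `s` factors is at most `(1 + R)‖x‖`, so `p` vanishes to order `s > 1`. -/
theorem hasFDerivAt_p_zero (hs : 2 ≤ B.numStrands) (hk : 1 ≤ 2 * k) (hq₁ : 0 ≤ q₁)
    (hq₂ : 0 ≤ q₂) : HasFDerivAt (B.p q₁ q₂ k a b) (0 : ℂ × ℂ →L[ℝ] ℂ) 0 := by
  obtain ⟨R, hR, hb⟩ := B.exists_norm_root_le (a := a) (b := b) hk hq₁ hq₂
  refine Asymptotics.IsBigO.hasFDerivAt (n := B.numStrands) ?_ (by omega)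
  refine Asymptotics.IsBigO.of_bound ((1 + R) ^ B.numStrands) ?_
  filter_upwards [Metric.ball_mem_nhds (0 : ℂ × ℂ) one_pos] with x hx
  rw [mem_ball_zero_iff] at hx
  rw [B.p_eq_prod (by linarith) hq₁ hq₂, sub_zero, norm_prod, norm_pow, norm_norm, ← mul_pow,
    ← B.card_strand, ← Finset.card_univ, ← Finset.prod_const]
  refine Finset.prod_le_prod (fun _ _ => norm_nonneg _) fun i _ => ?_
  have h2 := norm_snd_le x
  calc _ ≤ ‖x.1‖ + R * ‖x.2‖ := (norm_sub_le _ _).trans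
        (add_le_add le_rfl (hb i _ _ (norm_nonneg _) (h2.trans hx.le)))
    _ ≤ ‖x‖ + R * ‖x‖ := add_le_add (norm_fst_le x) (by gcongr)
    _ = _ := by ring

omit [Fintype 𝒞] in
theorem root_ne_root (ha : 0 < a) (hb : 0 < b) {r t : ℝ} (hr : 0 < r)
    (ht : t ∈ Set.Icc (0 : ℝ) (2 * Real.pi)) {i j : B.Strand} (hij : i ≠ j) :
    B.root q₁ q₂ k a b i r t ≠ B.root q₁ q₂ k a b j r t := by
  intro h
  apply B.disjoint t ht i j hij
  simp only [root, Complex.ext_iff, mul_eq_mul_left_iff, ha.ne', hb.ne', or_false,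
    (Real.rpow_pos_of_pos hr _).ne'] at h
  exact Prod.ext h.1 h.2

/-- For fixed `v`, `p` is a complex polynomial in `u` with simple roots; its nonzero complex
derivative at a root is onto `ℂ`. -/
theorem not_isCriticalPoint (ha : 0 < a) (hb : 0 < b) {w : ℂ × ℂ} (hw : w.2 ≠ 0)
    (h : B.p q₁ q₂ k a b w = 0) : ¬ IsCriticalPoint (B.p q₁ q₂ k a b) w := by
  classical
  obtain ⟨u, v⟩ := w
  obtain ⟨t, ht, hv⟩ := Complex.exists_angle v
  have hr : 0 < ‖v‖ := norm_pos_iff.2 hw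
  have hp : ∀ x, B.p q₁ q₂ k a b (x, v) = ∏ i, (x - B.root q₁ q₂ k a b i ‖v‖ t) := by
    intro x
    rw [← P_eq_prod B x hr, ← p_mul_exp B x t hr, ← hv]
  rw [hp, Finset.prod_eq_zero_iff] at h
  obtain ⟨i, -, hi⟩ := h
  let q (x : ℂ) : ℂ := ∏ j ∈ Finset.univ.erase i, (x - B.root q₁ q₂ k a b j ‖v‖ t)
  have hq0 : q u ≠ 0 := by
    refine Finset.prod_ne_zero_iff.2 fun j hj => ?_
    rw [sub_eq_zero.1 hi]
    exact sub_ne_zero.2 (B.root_ne_root ha hb hr ht (Finset.ne_of_mem_erase hj).symm)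
  have hq : DifferentiableAt ℂ q u :=
    DifferentiableAt.fun_finsetProd fun j _ => by fun_prop
  have hder : HasDerivAt (fun x => B.p q₁ q₂ k a b (x, v)) (q u) u := by
    have h1 := ((hasDerivAt_id u).sub_const (B.root q₁ q₂ k a b i ‖v‖ t)).mul hq.hasDerivAt
    simp only [id, hi, zero_mul, add_zero, one_mul] at h1
    refine h1.congr_of_eventuallyEq (Filter.Eventually.of_forall fun x => ?_)
    simp only [hp, Pi.mul_apply, q]
    exact (Finset.mul_prod_erase _ _ (Finset.mem_univ i)).symm
  have hL := (B.differentiableAt_p (q₁ := q₁) (q₂ := q₂) (k := k) (a := a) (b := b)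
    (w := (u, v)) hw).hasFDerivAt
  have hcomp := hL.comp u (hasFDerivAt_prodMk_left (𝕜 := ℝ) u v)
  have heq := hcomp.unique (hder.hasFDerivAt.restrictScalars ℝ)
  have hsurj : Function.Surjective
      (fderiv ℝ (B.p q₁ q₂ k a b) (u, v) : ℂ × ℂ →ₗ[ℝ] ℂ) := by
    intro y
    refine ⟨(y / q u, 0), ?_⟩
    have := DFunLike.congr_fun heq (y / q u)
    simpa [hq0] using this
  rw [IsCriticalPoint, LinearMap.range_eq_top.2 hsurj, finrank_top, Complex.finrank_real_complex]
  exact lt_irrefl _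

theorem isWeaklyIsolatedSingularPoint_p (hs : 2 ≤ B.numStrands) (hk : 1 ≤ 2 * k) (hq₁ : 0 ≤ q₁)
    (hq₂ : 0 ≤ q₂) (ha : 0 < a) (hb : 0 < b) :
    IsWeaklyIsolatedSingularPoint (B.p q₁ q₂ k a b) 0 := by
  have h := B.hasFDerivAt_p_zero (a := a) (b := b) hs hk hq₁ hq₂
  refine ⟨⟨h.differentiableAt, h.fderiv⟩, ?_, 1, one_pos, fun y _ hc h0 => ?_⟩
  · simp only [p, Prod.fst_zero, Prod.snd_zero, if_true]
    exact zero_pow (by omega)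
  · by_cases hy : y.2 = 0
    · rw [p, if_pos hy] at h0
      exact Prod.ext (pow_eq_zero_iff (by omega) |>.1 h0) hy
    · exact absurd hc (B.not_isCriticalPoint ha hb hy h0)

/-! ### The link type -/

theorem nodalLink_ambientIsotopic_closure (hs : 2 ≤ B.numStrands) (hk : 1 ≤ 2 * k)
    (hq₁ : 0 ≤ q₁) (hq₂ : 0 ≤ q₂) (ha : 0 < a) (hb : 0 < b) {ρ : ℝ} (hρ : 0 < ρ) (hρ1 : ρ ≤ 1) :
    AmbientIsotopic (B.nodalLink q₁ q₂ k a b ρ) (B.closure ρ) := by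
  obtain ⟨R, hR, hbd⟩ := B.exists_bound
  set K := 1 + (a ^ 2 + b ^ 2) * R ^ 2 with hK
  have hK1 : 1 ≤ K := by have : 0 ≤ (a ^ 2 + b ^ 2) * R ^ 2 := by positivity
                         linarith
  set r₀ := ρ / √K with hr₀
  have hr₀pos : 0 < r₀ := by positivity
  have hr₀1 : r₀ ≤ 1 := by
    rw [hr₀, div_le_one (by positivity)]
    exact hρ1.trans (Real.one_le_sqrt.2 hK1)
  -- The ideal factor `1 / (c r^(e-1))` can blow up at `r = 0`. Freezing it below `r₀` is harmless
  -- because the link stays in `|v| ≥ r₀`, as `low` shows.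
  let A (c e r : ℝ) : ℝ := (c * max r r₀ ^ (e - 1))⁻¹
  have mpos : ∀ r, 0 < max r r₀ := fun r => lt_max_of_lt_right hr₀pos
  have Apos : ∀ {c : ℝ} (e : ℝ), 0 < c → ∀ r, 0 < A c e r := fun e hc r =>
    inv_pos.2 (mul_pos hc (Real.rpow_pos_of_pos (mpos r) _))
  have Aanti : ∀ {c e : ℝ}, 0 < c → 1 ≤ e → AntitoneOn (A c e) (Set.Ici 0) := by
    intro c e hc he x _ y _ hxy
    refine inv_anti₀ (mul_pos hc (Real.rpow_pos_of_pos (mpos x) _))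
      (mul_le_mul_of_nonneg_left ?_ hc.le)
    exact Real.rpow_le_rpow (mpos x).le (max_le_max_right _ hxy) (by linarith)
  have Acont : ∀ {c : ℝ} (e : ℝ), 0 < c → Continuous (A c e) := by
    intro c e hc
    refine Continuous.inv₀ (continuous_const.mul (Continuous.rpow_const (by fun_prop)
      fun r => Or.inl (mpos r).ne')) fun r => ?_
    exact (mul_pos hc (Real.rpow_pos_of_pos (mpos r) _)).ne'
  have Aeq : ∀ {c e r : ℝ}, 0 < c → r₀ ≤ r → ∀ x, A c e r * (r ^ e * (c * x)) = r * x := by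
    intro c e r hc hr x
    have h0 : 0 < r := hr₀pos.trans_le hr
    have h1 := (Real.rpow_pos_of_pos h0 (e - 1)).ne'
    simp only [A, max_eq_left hr]
    rw [show r ^ e = r ^ (e - 1) * r by rw [← Real.rpow_add_one h0.ne']; congr 1; ring]
    field_simp
  -- Here `ρ² ≤ K r²`. The numbers `m`, `n` stand for `r^(e-1)` on the nodal link and for `max r r₀
  -- ^ (e-1)` on the preimage of the closed braid, where `r₀ ≤ r` is not yet known.
  have low : ∀ {ξ η r x y m n : ℝ}, 0 ≤ r → 0 ≤ m → m ≤ 1 → 0 ≤ n → n ≤ 1 → |x| ≤ R → |y| ≤ R →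
      ξ = a * m * (r * x) → η = b * n * (r * y) → ξ ^ 2 + η ^ 2 + r ^ 2 = ρ ^ 2 → r₀ ≤ r := by
    intro ξ η r x y m n hr hm hm1 hn hn1 hx hy hξ hη h
    rw [hr₀, div_le_iff₀ (by positivity)]
    refine abs_le_of_sq_le_sq' ?_ (by positivity) |>.2
    rw [mul_pow, Real.sq_sqrt (by positivity), ← h, hξ, hη]
    have h1 : x ^ 2 ≤ R ^ 2 := sq_le_sq' (abs_le.1 hx).1 (abs_le.1 hx).2
    have h2 : y ^ 2 ≤ R ^ 2 := sq_le_sq' (abs_le.1 hy).1 (abs_le.1 hy).2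
    have h3 : m ^ 2 * x ^ 2 ≤ 1 * R ^ 2 := by gcongr; exact pow_le_one₀ hm hm1
    have h4 : n ^ 2 * y ^ 2 ≤ 1 * R ^ 2 := by gcongr; exact pow_le_one₀ hn hn1
    have h5 := mul_le_mul_of_nonneg_left h3 (by positivity : 0 ≤ a ^ 2 * r ^ 2)
    have h6 := mul_le_mul_of_nonneg_left h4 (by positivity : 0 ≤ b ^ 2 * r ^ 2)
    rw [hK]
    linear_combination h5 + h6
  have e₁ : 1 ≤ 2 * k + q₁ := by linarith
  have e₂ : 1 ≤ 2 * k + q₂ := by linarith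
  refine ambientIsotopic_of_sphereStretch hρ (Apos (2 * k + q₁) ha) (Apos (2 * k + q₂) hb)
    (Aanti ha e₁) (Aanti hb e₂) (Acont _ ha) (Acont _ hb) ?_
  rintro ⟨⟨u, v⟩, hx⟩ ⟨y, hy⟩ hxy
  have hx2 := hx
  simp only at hxy
  simp only [sphereThree, Set.mem_ofPred_eq, Complex.norm_sq_eq_re_im u] at hx
  have hv1 : ‖v‖ ≤ 1 := by
    refine (abs_le_of_sq_le_sq' ?_ zero_le_one).2
    nlinarith [sq_nonneg u.re, sq_nonneg u.im]
  have expn : ∀ t : ℝ, ‖Complex.exp (Complex.I * (t : ℂ))‖ = 1 := fun t => by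
    rw [mul_comm]; exact Complex.norm_exp_ofReal_mul_I t
  have emb : ∀ (z : ℂ) (t : ℝ), solidTorusEmbedding ρ z t =
      (ρ / √(1 + ‖z‖ ^ 2)) • (z, Complex.exp (Complex.I * (t : ℂ))) := by
    intro z t
    simp only [solidTorusEmbedding, Prod.smul_mk, Complex.real_smul]
  have nrm : ∀ (z : ℂ) (t : ℝ),
      euclideanNorm (z, Complex.exp (Complex.I * (t : ℂ))) = √(1 + ‖z‖ ^ 2) := by
    intro z t
    rw [euclideanNorm, expn, one_pow, add_comm]
  constructor
  · intro h
    change B.p q₁ q₂ k a b (u, v) = 0 at h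
    have hv : v ≠ 0 := by
      rintro rfl
      rw [p, if_pos rfl] at h
      have hu : u = 0 := pow_eq_zero_iff (by omega) |>.1 h
      exact ne_zero_of_mem_sphereThree hρ hx2 (by rw [hu]; rfl)
    have hr := norm_pos_iff.2 hv
    obtain ⟨t, ht, hvt⟩ := Complex.exists_angle v
    rw [hvt, p_mul_exp B u t hr, P_eq_prod B u hr, Finset.prod_eq_zero_iff] at h
    obtain ⟨i, -, hi⟩ := h
    refine ⟨i, t, ht, Subtype.ext ?_⟩
    have hui : u = B.root q₁ q₂ k a b i ‖v‖ t := sub_eq_zero.1 hi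
    have hre : u.re = _ := congrArg Complex.re hui
    have him : u.im = _ := congrArg Complex.im hui
    simp only [root] at hre him
    have hpow : ∀ e : ℝ, ‖v‖ ^ e = ‖v‖ ^ (e - 1) * ‖v‖ := fun e => by
      rw [← Real.rpow_add_one hr.ne']; congr 1; ring
    have hle : ∀ {e : ℝ}, 1 ≤ e → ‖v‖ ^ (e - 1) ≤ 1 := fun he =>
      Real.rpow_le_one hr.le hv1 (by linarith)
    have hr₀v : r₀ ≤ ‖v‖ := by
      refine low hr.le (Real.rpow_nonneg hr.le _) (hle e₁) (Real.rpow_nonneg hr.le _) (hle e₂)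
        (hbd i t).1 (hbd i t).2 ?_ ?_ hx
      · rw [hre, hpow]; ring
      · rw [him, hpow]; ring
    have hst : stretch (A a (2 * k + q₁)) (A b (2 * k + q₂)) (u, v) =
        ‖v‖ • ((⟨B.X i t, B.Y i t⟩ : ℂ), Complex.exp (Complex.I * (t : ℂ))) := by
      simp only [stretch, hre, him, Aeq ha hr₀v, Aeq hb hr₀v]
      refine Prod.ext (Complex.ext ?_ ?_) ?_
      · simp
      · simp
      · simpa using hvt
    change y = solidTorusEmbedding ρ ⟨B.X i t, B.Y i t⟩ t
    rw [← hxy, sphereStretch, hst, euclideanNorm_smul _ hr.le, nrm, emb, smul_smul]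
    congr 1
    field_simp
  · rintro ⟨i, t, ht, hyt⟩
    have hyt' : y = solidTorusEmbedding ρ ⟨B.X i t, B.Y i t⟩ t := congrArg Subtype.val hyt
    change B.p q₁ q₂ k a b (u, v) = 0
    have hd := euclideanNorm_pos (stretch_ne_zero (Apos (2 * k + q₁) ha) (Apos (2 * k + q₂) hb)
      (ne_zero_of_mem_sphereThree hρ hx2))
    rw [hyt', sphereStretch, emb] at hxy
    set d := euclideanNorm (stretch (A a (2 * k + q₁)) (A b (2 * k + q₂)) (u, v))
    set n := √(1 + ‖(⟨B.X i t, B.Y i t⟩ : ℂ)‖ ^ 2) with hn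
    have hnpos : 0 < n := by positivity
    have hst : stretch (A a (2 * k + q₁)) (A b (2 * k + q₂)) (u, v) =
        (d / n) • ((⟨B.X i t, B.Y i t⟩ : ℂ), Complex.exp (Complex.I * (t : ℂ))) := by
      have := congrArg (fun x => (d / ρ) • x) hxy
      simp only [smul_smul] at this
      rw [show d / ρ * (ρ / d) = 1 by field_simp, one_smul,
        show d / ρ * (ρ / n) = d / n by field_simp] at this
      exact this
    set c := d / n
    have hc : 0 < c := div_pos hd hnpos
    simp only [stretch, Prod.smul_mk, Prod.mk.injEq, Complex.ext_iff, Complex.smul_re,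
      Complex.smul_im, smul_eq_mul] at hst
    obtain ⟨⟨h1, h2⟩, h3⟩ := hst
    have hv : v = (c : ℂ) * Complex.exp (Complex.I * (t : ℂ)) := by
      rw [← Complex.real_smul]
      exact Complex.ext (by rw [h3.1, Complex.smul_re, smul_eq_mul])
        (by rw [h3.2, Complex.smul_im, smul_eq_mul])
    have hvc : ‖v‖ = c := by
      rw [hv, norm_mul, expn, Complex.norm_real, Real.norm_of_nonneg hc.le, mul_one]
    rw [hvc] at h1 h2 hx hv1
    have hm0 : ∀ e : ℝ, 0 ≤ max c r₀ ^ (e - 1) := fun e => Real.rpow_nonneg (mpos c).le _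
    have hm1 : ∀ {e : ℝ}, 1 ≤ e → max c r₀ ^ (e - 1) ≤ 1 := fun he =>
      Real.rpow_le_one (mpos c).le (max_le hv1 hr₀1) (by linarith)
    have hsolve : ∀ {a e x X : ℝ}, 0 < a → A a e c * x = c * X →
        x = a * max c r₀ ^ (e - 1) * (c * X) := by
      intro a e x X ha h
      have h0 := (Real.rpow_pos_of_pos (mpos c) (e - 1)).ne'
      rw [← h]
      simp only [A]
      field_simp
    have hr₀c : r₀ ≤ c := low hc.le (hm0 _) (hm1 e₁) (hm0 _) (hm1 e₂) (hbd i t).1 (hbd i t).2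
      (hsolve ha h1) (hsolve hb h2) hx
    have hu : u = B.root q₁ q₂ k a b i c t := by
      refine Complex.ext ?_ ?_
      · exact mul_left_cancel₀ (Apos (2 * k + q₁) ha c).ne' (h1.trans (Aeq ha hr₀c _).symm)
      · exact mul_left_cancel₀ (Apos (2 * k + q₂) hb c).ne' (h2.trans (Aeq hb hr₀c _).symm)
    rw [hv, p_mul_exp B u t hc, P_eq_prod B u hc]
    exact Finset.prod_eq_zero (Finset.mem_univ i) (sub_eq_zero.2 hu)

end FourierBraid

/-! ### Trigonometric polynomials and semiholomorphic polynomials -/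

/-- The function `t ↦ e^{int/L}`. -/
def trigMonomial (L : ℕ) (n : ℤ) (t : ℝ) : ℂ := Complex.exp (Complex.I * n * (t / L : ℝ))

theorem trigMonomial_add (L : ℕ) (m n : ℤ) :
    trigMonomial L (m + n) = trigMonomial L m * trigMonomial L n := by
  funext t
  simp only [trigMonomial, Pi.mul_apply, ← Complex.exp_add]
  congr 1
  push_cast
  ring

/-- The algebra of trigonometric polynomials in `t/L`. -/
def trigPolynomials (L : ℕ) : Subalgebra ℂ (ℝ → ℂ) :=
  Algebra.adjoin ℂ (Set.range (trigMonomial L))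

theorem trigMonomial_mem (L : ℕ) (n : ℤ) : trigMonomial L n ∈ trigPolynomials L :=
  Algebra.subset_adjoin ⟨n, rfl⟩

theorem trigPolynomials_toSubmodule (L : ℕ) :
    Subalgebra.toSubmodule (trigPolynomials L) =
      Submodule.span ℂ (Set.range (trigMonomial L)) := by
  let S : Submonoid (ℝ → ℂ) :=
    { carrier := Set.range (trigMonomial L)
      one_mem' := ⟨0, by funext t; simp [trigMonomial]⟩
      mul_mem' := by
        rintro _ _ ⟨m, rfl⟩ ⟨n, rfl⟩
        exact ⟨m + n, trigMonomial_add L m n⟩ }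
  rw [trigPolynomials, Algebra.adjoin_eq_span]
  congr 1
  exact congrArg SetLike.coe (Submonoid.closure_eq S)

/-- Summation over the translates by the multiples `2πm`, `m < L`. -/
def sumTranslates (L : ℕ) : (ℝ → ℂ) →ₗ[ℂ] (ℝ → ℂ) where
  toFun h t := ∑ m ∈ Finset.range L, h (t + m * (2 * Real.pi))
  map_add' h h' := by funext t; simp [Finset.sum_add_distrib]
  map_smul' c h := by funext t; simp [Finset.mul_sum]

/-- The translates form a geometric sum in the `L`-th root of unity `ζ`. It vanishes unless `ζ = 1`,
that is, unless `L ∣ n`. -/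
theorem sumTranslates_trigMonomial_mem {L : ℕ} (hL : 0 < L) (n : ℤ) :
    sumTranslates L (trigMonomial L n) ∈ Submodule.span ℂ (Set.range (trigMonomial 1)) := by
  have hL' : (L : ℂ) ≠ 0 := by exact_mod_cast hL.ne'
  set ζ := Complex.exp (n / L * (2 * Real.pi * Complex.I)) with hζ
  have e : sumTranslates L (trigMonomial L n) =
      (∑ m ∈ Finset.range L, ζ ^ m) • trigMonomial L n := by
    funext t
    simp only [sumTranslates, LinearMap.coe_mk, AddHom.coe_mk, Pi.smul_apply, smul_eq_mul,
      Finset.sum_mul]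
    refine Finset.sum_congr rfl fun m _ => ?_
    rw [hζ, ← Complex.exp_nat_mul, trigMonomial, trigMonomial, ← Complex.exp_add]
    congr 1
    push_cast
    field_simp
    ring
  rw [e]
  by_cases h : ζ = 1
  · obtain ⟨j, hj⟩ := Complex.exp_eq_one_iff.1 h
    have hj' : (n : ℂ) / L = j := mul_right_cancel₀ Complex.two_pi_I_ne_zero hj
    have : trigMonomial L n = trigMonomial 1 j := by
      funext t
      rw [trigMonomial, trigMonomial, ← hj']
      congr 1
      push_cast
      field_simp
    rw [this]
    exact Submodule.smul_mem _ _ (Submodule.subset_span ⟨j, rfl⟩)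
  · have hL1 : ζ ^ L = 1 := by
      rw [hζ, ← Complex.exp_nat_mul, Complex.exp_eq_one_iff]
      exact ⟨n, by field_simp⟩
    rw [geom_sum_eq h, hL1, sub_self, zero_div, zero_smul]
    exact Submodule.zero_mem _

/-- A periodic function equals its average over the translates, and averaging kills the fractional
frequencies. -/
theorem mem_span_trigMonomial_one_of_periodic {L : ℕ} (hL : 0 < L) {h : ℝ → ℂ}
    (hh : h ∈ trigPolynomials L) (hp : Function.Periodic h (2 * Real.pi)) :
    h ∈ Submodule.span ℂ (Set.range (trigMonomial 1)) := by
  have hL' : (L : ℂ) ≠ 0 := by exact_mod_cast hL.ne'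
  have hh' : h ∈ Submodule.span ℂ (Set.range (trigMonomial L)) := by
    rw [← trigPolynomials_toSubmodule]; exact hh
  have h1 : Submodule.span ℂ (Set.range (trigMonomial L)) ≤
      (Submodule.span ℂ (Set.range (trigMonomial 1))).comap (sumTranslates L) := by
    rw [Submodule.span_le]
    rintro _ ⟨n, rfl⟩
    exact sumTranslates_trigMonomial_mem hL n
  have h2 : sumTranslates L h = (L : ℂ) • h := by
    funext t
    have : ∀ m : ℕ, h (t + m * (2 * Real.pi)) = h t := fun m => hp.nat_mul m t
    simp [sumTranslates, this]
  have h3 : (L : ℂ)⁻¹ • sumTranslates L h ∈ Submodule.span ℂ (Set.range (trigMonomial 1)) :=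
    Submodule.smul_mem _ _ (h1 hh')
  rwa [h2, smul_smul, inv_mul_cancel₀ hL', one_smul] at h3

theorem re_sum_exp_mem {L n : ℕ} (hL : 0 < L) (hn : n ∣ L) (s : Finset ℤ) (c : ℤ → ℂ) (d : ℝ) :
    (fun t : ℝ => ((∑ j ∈ s, c j * Complex.exp (Complex.I * (j : ℂ) *
      (((t + d) / n : ℝ) : ℂ))).re : ℂ)) ∈ trigPolynomials L := by
  obtain ⟨m, rfl⟩ := hn
  have hn0 : (n : ℂ) ≠ 0 := by
    have : n ≠ 0 := by rintro rfl; simp at hL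
    exact_mod_cast this
  have hm0 : (m : ℂ) ≠ 0 := by
    have : m ≠ 0 := by rintro rfl; simp at hL
    exact_mod_cast this
  have key : (fun t : ℝ => ((∑ j ∈ s, c j * Complex.exp (Complex.I * (j : ℂ) *
      (((t + d) / n : ℝ) : ℂ))).re : ℂ)) =
      -- The real part is half the sum with the conjugate; frequency `j/n` is `jm/L` with `L = nm`.
      ∑ j ∈ s, ((c j * Complex.exp (Complex.I * j * (d / n : ℝ)) / 2) •
          trigMonomial (n * m) (j * m) +
        ((starRingEnd ℂ) (c j * Complex.exp (Complex.I * j * (d / n : ℝ))) / 2) •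
          trigMonomial (n * m) (-(j * m))) := by
    funext t
    rw [Complex.re_eq_add_conj, map_sum, ← Finset.sum_add_distrib, Finset.sum_div,
      Finset.sum_apply]
    refine Finset.sum_congr rfl fun j _ => ?_
    have e₁ : Complex.exp (Complex.I * j * (((t + d) / n : ℝ) : ℂ)) =
        Complex.exp (Complex.I * j * (d / n : ℝ)) * trigMonomial (n * m) (j * m) t := by
      rw [trigMonomial, ← Complex.exp_add]
      congr 1
      push_cast
      field_simp
      ring
    have e₂ : (starRingEnd ℂ) (trigMonomial (n * m) (j * m) t) =
        trigMonomial (n * m) (-(j * m)) t := by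
      simp only [trigMonomial, ← Complex.exp_conj, map_mul, Complex.conj_I, Complex.conj_ofReal,
        map_intCast]
      congr 1
      push_cast
      ring
    simp only [Pi.add_apply, Pi.smul_apply, smul_eq_mul, e₁, map_mul, e₂]
    ring
  rw [key]
  exact sum_mem fun j _ => add_mem (Subalgebra.smul_mem _ (trigMonomial_mem _ _) _)
    (Subalgebra.smul_mem _ (trigMonomial_mem _ _) _)

/-- The functions of `(u, t)` that are given by a polynomial in `u`, `v`, `conj v` without mixed
monomials in `v`, `conj v`, at `v = e^{it}`. -/
def semiholomorphicFunctions : Submodule ℂ (ℂ → ℝ → ℂ) where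
  carrier := {φ | ∃ f : MvPolynomial (Fin 3) ℂ, (∀ m ∈ f.support, m 1 = 0 ∨ m 2 = 0) ∧
    ∀ (u : ℂ) (t : ℝ), MvPolynomial.eval ![u, Complex.exp (Complex.I * (t : ℂ)),
      (starRingEnd ℂ) (Complex.exp (Complex.I * (t : ℂ)))] f = φ u t}
  zero_mem' := ⟨0, by simp⟩
  add_mem' := by
    classical
    rintro φ φ' ⟨f, hf, h⟩ ⟨f', hf', h'⟩
    refine ⟨f + f', fun m hm => ?_, fun u t => by rw [map_add, h, h']; rfl⟩
    rcases Finset.mem_union.1 (MvPolynomial.support_add hm) with hm | hm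
    exacts [hf m hm, hf' m hm]
  smul_mem' := by
    rintro c φ ⟨f, hf, h⟩
    exact ⟨c • f, fun m hm => hf m (MvPolynomial.support_smul hm),
      fun u t => by rw [MvPolynomial.smul_eval, h]; rfl⟩

theorem pow_mul_trigMonomial_mem (m : ℕ) (n : ℤ) :
    (fun u t => u ^ m * trigMonomial 1 n t) ∈ semiholomorphicFunctions := by
  classical
  obtain ⟨j, rfl | rfl⟩ := n.eq_nat_or_neg
  · refine ⟨MvPolynomial.monomial (Finsupp.single 0 m + Finsupp.single 1 j) 1, fun d hd => ?_,
      fun u t => ?_⟩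
    · rw [Finset.mem_singleton.1 (MvPolynomial.support_monomial_subset hd)]
      right; simp
    · rw [MvPolynomial.eval_monomial, Finsupp.prod_fintype _ _ (by simp)]
      simp [Fin.prod_univ_three, trigMonomial, ← Complex.exp_nat_mul]
      left
      congr 1
      ring
  · refine ⟨MvPolynomial.monomial (Finsupp.single 0 m + Finsupp.single 2 j) 1, fun d hd => ?_,
      fun u t => ?_⟩
    · rw [Finset.mem_singleton.1 (MvPolynomial.support_monomial_subset hd)]
      left; simp
    · rw [MvPolynomial.eval_monomial, Finsupp.prod_fintype _ _ (by simp)]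
      simp [Fin.prod_univ_three, trigMonomial, ← Complex.exp_nat_mul, ← Complex.exp_conj]
      left
      congr 1
      ring

theorem pow_mul_mem_semiholomorphicFunctions (m : ℕ) {c : ℝ → ℂ}
    (hc : c ∈ Submodule.span ℂ (Set.range (trigMonomial 1))) :
    (fun u t => u ^ m * c t) ∈ semiholomorphicFunctions := by
  let T : (ℝ → ℂ) →ₗ[ℂ] (ℂ → ℝ → ℂ) :=
    { toFun := fun c u t => u ^ m * c t
      map_add' := fun c c' => by funext u t; simp [mul_add]
      map_smul' := fun r c => by funext u t; simp; ring }
  have h : Submodule.span ℂ (Set.range (trigMonomial 1)) ≤ semiholomorphicFunctions.comap T := by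
    rw [Submodule.span_le]
    rintro _ ⟨n, rfl⟩
    exact pow_mul_trigMonomial_mem m n
  exact h hc

/-- The function of `(u, t)` that the monomial with exponent `d` defines, as a homomorphism. -/
def monomialHom (d : Fin 3 →₀ ℕ) : ℂ × Multiplicative ℝ →* ℂ where
  toFun x := x.1 ^ d 0 * Complex.exp (Complex.I * ((d 1 : ℝ) - d 2 : ℝ) * (x.2.toAdd : ℝ))
  map_one' := by simp
  map_mul' x y := by
    simp only [Prod.fst_mul, Prod.snd_mul, toAdd_mul, Complex.ofReal_add, mul_add,
      Complex.exp_add, mul_pow]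
    ring

theorem eval_monomial_eq_monomialHom (d : Fin 3 →₀ ℕ) (c u : ℂ) (t : ℝ) :
    MvPolynomial.eval ![u, Complex.exp (Complex.I * (t : ℂ)),
      (starRingEnd ℂ) (Complex.exp (Complex.I * (t : ℂ)))] (MvPolynomial.monomial d c) =
      c * monomialHom d (u, Multiplicative.ofAdd t) := by
  rw [MvPolynomial.eval_monomial, Finsupp.prod_fintype _ _ (by simp)]
  simp only [Fin.prod_univ_three, monomialHom, MonoidHom.coe_mk, OneHom.coe_mk,
    ← Complex.exp_conj, map_mul, Complex.conj_I, Complex.conj_ofReal, Matrix.cons_val,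
    ← Complex.exp_nat_mul, mul_assoc, ← Complex.exp_add, toAdd_ofAdd]
  congr 3
  push_cast
  ring

/-- The value at `u = 2`, `t = 0` determines `d 0`. If the frequencies differed by `D ≠ 0`, the two
characters would have opposite signs at `u = 1`, `t = π/D`. Without mixed monomials the frequency `d
1 - d 2` determines both exponents. -/
theorem monomialHom_injOn : Set.InjOn monomialHom {d | d 1 = 0 ∨ d 2 = 0} := by
  intro d hd d' hd' h
  have h0 : d 0 = d' 0 := by
    have := DFunLike.congr_fun h (2, 1)
    simp only [monomialHom, MonoidHom.coe_mk, OneHom.coe_mk, toAdd_one, Complex.ofReal_zero,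
      mul_zero, Complex.exp_zero, mul_one] at this
    exact Nat.pow_right_injective le_rfl (by exact_mod_cast this)
  have h1 : ((d 1 : ℝ) - d 2) - ((d' 1 : ℝ) - d' 2) = 0 := by
    by_contra hne
    set D := ((d 1 : ℝ) - d 2) - ((d' 1 : ℝ) - d' 2) with hD
    have := DFunLike.congr_fun h (1, Multiplicative.ofAdd (Real.pi / D))
    simp only [monomialHom, MonoidHom.coe_mk, OneHom.coe_mk, toAdd_ofAdd, one_pow, one_mul] at this
    have e : Complex.exp (Complex.I * ((d 1 : ℝ) - d 2 : ℝ) * (Real.pi / D : ℝ)) =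
        Complex.exp (Complex.I * ((d' 1 : ℝ) - d' 2 : ℝ) * (Real.pi / D : ℝ)) *
          Complex.exp (Real.pi * Complex.I) := by
      rw [← Complex.exp_add]
      congr 1
      have hne' : (D : ℂ) ≠ 0 := by exact_mod_cast hne
      rw [show ((d 1 : ℝ) - d 2) = D + ((d' 1 : ℝ) - d' 2) by rw [hD]; ring]
      push_cast
      field_simp
      ring
    rw [e, Complex.exp_pi_mul_I] at this
    have h2 := Complex.exp_ne_zero (Complex.I * ((d' 1 : ℝ) - d' 2 : ℝ) * (Real.pi / D : ℝ))
    apply h2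
    linear_combination (-1 / 2 : ℂ) * this
  have h2 : d 1 + d' 2 = d' 1 + d 2 := by
    have : (d 1 : ℝ) + d' 2 = d' 1 + d 2 := by linarith
    exact_mod_cast this
  simp only [Set.mem_ofPred_eq] at hd hd'
  ext i
  fin_cases i
  · exact h0
  · simp only [Fin.mk_one]; omega
  · simp only [Fin.reduceFinMk]; omega

/-- Distinct monomials give distinct multiplicative characters, which are linearly independent by
Dedekind's theorem. -/
theorem eq_zero_of_eval_eq_zero {f : MvPolynomial (Fin 3) ℂ}
    (hf : ∀ m ∈ f.support, m 1 = 0 ∨ m 2 = 0)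
    (h : ∀ (u : ℂ) (t : ℝ), MvPolynomial.eval ![u, Complex.exp (Complex.I * (t : ℂ)),
      (starRingEnd ℂ) (Complex.exp (Complex.I * (t : ℂ)))] f = 0) : f = 0 := by
  have li := (linearIndependent_monoidHom (ℂ × Multiplicative ℝ) ℂ).comp
    (fun d : f.support => monomialHom d)
    (fun d d' e => Subtype.ext (monomialHom_injOn (hf _ d.2) (hf _ d'.2) e))
  rw [Fintype.linearIndependent_iff] at li
  have hz := li (fun d => f.coeff d) (by
    funext ⟨u, t⟩
    have := h u t.toAdd
    rw [f.as_sum, map_sum] at this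
    simp only [eval_monomial_eq_monomialHom, ofAdd_toAdd] at this
    rw [← Finset.sum_attach] at this
    simpa [Finset.sum_apply] using this)
  ext d
  by_contra hd
  have hd' : d ∈ f.support := MvPolynomial.mem_support_iff.2 hd
  exact hd (hz ⟨d, hd'⟩)

/-! ### Existence, uniqueness and degree of `f_{a,b}` -/

namespace FourierBraid

variable {𝒞 : Type*} [Fintype 𝒞] (B : FourierBraid 𝒞)

/-- The position of a strand in the plane, scaled by `a` and `b`. -/
def position (a b : ℝ) (i : B.Strand) (t : ℝ) : ℂ :=
  (a : ℂ) * (B.X i t : ℂ) + (b : ℂ) * Complex.I * (B.Y i t : ℂ)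

theorem g_eq_eval (a b : ℝ) (u : ℂ) (t : ℝ) :
    B.g a b u t =
      (∏ i, (Polynomial.X - Polynomial.C (B.position a b i t))).eval u := by
  simp only [g, position, Polynomial.eval_prod, Polynomial.eval_sub, Polynomial.eval_X,
    Polynomial.eval_C, sub_sub]

theorem position_mem (a b : ℝ) (i : B.Strand) :
    B.position a b i ∈ trigPolynomials (∏ C, B.strands C) := by
  have hL : 0 < ∏ C, B.strands C := Finset.prod_pos fun C _ => B.strands_pos C
  have hd : B.strands i.1 ∣ ∏ C, B.strands C := Finset.dvd_prod_of_mem _ (Finset.mem_univ _)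
  exact add_mem
    (Subalgebra.smul_mem _ (re_sum_exp_mem hL hd _ (B.coeffA i.1) _) (a : ℂ))
    (Subalgebra.smul_mem _ (re_sum_exp_mem hL hd _ (B.coeffB i.1) _) ((b : ℂ) * Complex.I))

theorem exists_isSemiholomorphicPolynomial (a b : ℝ) :
    ∃ f, B.IsSemiholomorphicPolynomial a b f := by
  have hL : 0 < ∏ C, B.strands C := Finset.prod_pos fun C _ => B.strands_pos C
  let S := trigPolynomials (∏ C, B.strands C)
  -- With coefficients taken in the subalgebra `S`, every `u`-coefficient of `g` is a trigonometric
  -- polynomial in `t/L` by construction. Periodicity holds only for these symmetric combinations of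
  -- the strands.
  let Q : Polynomial S :=
    ∏ i, (Polynomial.X - Polynomial.C ⟨B.position a b i, B.position_mem a b i⟩)
  let ev (t : ℝ) : S →+* ℂ := (Pi.evalRingHom (fun _ : ℝ => ℂ) t).comp (S.val : S →+* (ℝ → ℂ))
  have hQ : ∀ t, Q.map (ev t) =
      ∏ i, (Polynomial.X - Polynomial.C (B.position a b i t)) := by
    intro t
    simp only [Q, Polynomial.map_prod, Polynomial.map_sub, Polynomial.map_X, Polynomial.map_C]
    rfl
  have hper : ∀ m, Function.Periodic (Q.coeff m : ℝ → ℂ) (2 * Real.pi) := by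
    intro m t
    have h1 : ∀ t, (Q.coeff m : ℝ → ℂ) t = (Q.map (ev t)).coeff m := fun t => by
      rw [Polynomial.coeff_map]; rfl
    rw [h1, h1, hQ, hQ]
    exact congrArg (fun q => Polynomial.coeff q m) (B.prod_strand_add_two_pi
      (fun x y => Polynomial.X -
        Polynomial.C ((a : ℂ) * (x : ℂ) + (b : ℂ) * Complex.I * (y : ℂ))) t)
  have hg : B.g a b = ∑ m ∈ Finset.range (Q.natDegree + 1),
      fun u t => u ^ m * (Q.coeff m : ℝ → ℂ) t := by
    funext u t
    rw [g_eq_eval, ← hQ, Polynomial.eval_eq_sum_range'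
      (Nat.lt_succ_of_le Polynomial.natDegree_map_le)]
    simp only [Finset.sum_apply, Polynomial.coeff_map]
    exact Finset.sum_congr rfl fun m _ => mul_comm _ _
  have hmem : B.g a b ∈ semiholomorphicFunctions := by
    rw [hg]
    exact sum_mem fun m _ => pow_mul_mem_semiholomorphicFunctions m
      (mem_span_trigMonomial_one_of_periodic hL (Q.coeff m).2 (hper m))
  exact hmem

theorem IsSemiholomorphicPolynomial.unique {a b : ℝ} {f f' : MvPolynomial (Fin 3) ℂ}
    (hf : B.IsSemiholomorphicPolynomial a b f) (hf' : B.IsSemiholomorphicPolynomial a b f') :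
    f = f' := by
  classical
  refine sub_eq_zero.1 (eq_zero_of_eval_eq_zero (fun m hm => ?_) fun u t => ?_)
  · rcases Finset.mem_union.1 (MvPolynomial.support_sub _ _ _ hm) with hm | hm
    exacts [hf.1 m hm, hf'.1 m hm]
  · rw [map_sub, hf.2, hf'.2, sub_self]

/-- At `v = conj v = 1`, that is `t = 0`, `f` becomes a monic polynomial of degree `s` in `u`, and
this substitution cannot raise the degree. -/
theorem IsSemiholomorphicPolynomial.numStrands_le_totalDegree {a b : ℝ}
    {f : MvPolynomial (Fin 3) ℂ} (hf : B.IsSemiholomorphicPolynomial a b f) :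
    B.numStrands ≤ f.totalDegree := by
  have h : MvPolynomial.aeval ![Polynomial.X, Polynomial.C 1, Polynomial.C 1] f =
      ∏ i, (Polynomial.X - Polynomial.C (B.position a b i 0)) := by
    refine Polynomial.funext fun u => ?_
    rw [← g_eq_eval, ← hf.2, ← Polynomial.coe_evalRingHom, MvPolynomial.aeval_def,
      MvPolynomial.eval₂_comp_left, MvPolynomial.eval, MvPolynomial.coe_eval₂Hom]
    congr 1
    · ext x
      simp
    · funext i
      fin_cases i <;> simp
  have hd := MvPolynomial.aeval_natDegree_le f le_rfl
    ![Polynomial.X, Polynomial.C 1, Polynomial.C 1] (n := 1) (by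
      intro i
      fin_cases i <;> simp)
  rw [h, Polynomial.natDegree_prod_of_monic _ _ fun i _ => Polynomial.monic_X_sub_C _] at hd
  simpa only [Polynomial.natDegree_X_sub_C, Finset.sum_const, Finset.card_univ, card_strand,
    smul_eq_mul, mul_one] using hd

end FourierBraid

end

theorem lemma1 {𝒞 : Type*} [Fintype 𝒞] (B : FourierBraid 𝒞) (hs : 2 ≤ B.numStrands) :
    -- the semiholomorphic polynomial `f_{a,b}` exists and is unique
    (∀ a b : ℝ, 0 < a → 0 < b →
      ∃! f : MvPolynomial (Fin 3) ℂ, B.IsSemiholomorphicPolynomial a b f) ∧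
    ∀ q₁ q₂ k : ℝ, 0 ≤ q₁ → 0 ≤ q₂ →
      -- `p_{a,b,k}` is well defined by `P_{a,b,k}` and its continuous extension `u^s` to `v = 0`
      (∀ a b : ℝ, 0 < a → 0 < b →
        ∀ f : MvPolynomial (Fin 3) ℂ, B.IsSemiholomorphicPolynomial a b f →
          (f.totalDegree : ℝ) / (2 * (B.numStrands : ℝ)) ≤ k →
            (∀ (u : ℂ) (r t : ℝ), 0 < r →
              B.p q₁ q₂ k a b (u, (r : ℂ) * Complex.exp (Complex.I * (t : ℂ))) =
                B.P q₁ q₂ k a b u r t) ∧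
            Continuous (B.p q₁ q₂ k a b)) ∧
      -- weak isolation and the link type, for all small `a` and `b`
      ∃ ε : ℝ, 0 < ε ∧ ∀ a b : ℝ, 0 < a → a < ε → 0 < b → b < ε →
        ∀ f : MvPolynomial (Fin 3) ℂ, B.IsSemiholomorphicPolynomial a b f →
          (f.totalDegree : ℝ) / (2 * (B.numStrands : ℝ)) ≤ k →
            IsWeaklyIsolatedSingularPoint (B.p q₁ q₂ k a b) 0 ∧
            ∀ ρ : ℝ, 0 < ρ → ρ ≤ 1 →
              AmbientIsotopic (B.nodalLink q₁ q₂ k a b ρ) (B.closure ρ) := by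
  refine ⟨fun a b _ _ => ?_, fun q₁ q₂ k hq₁ hq₂ => ?_⟩
  · obtain ⟨f, hf⟩ := B.exists_isSemiholomorphicPolynomial a b
    exact ⟨f, hf, fun f' hf' => hf'.unique B hf⟩
  -- `k ≥ deg f / (2s) ≥ s / (2s) = 1/2`.
  have hk : ∀ (a b : ℝ) (f : MvPolynomial (Fin 3) ℂ), B.IsSemiholomorphicPolynomial a b f →
      (f.totalDegree : ℝ) / (2 * (B.numStrands : ℝ)) ≤ k → 1 ≤ 2 * k := by
    intro a b f hf h
    have hs0 : (0 : ℝ) < B.numStrands := by exact_mod_cast (by omega : 0 < B.numStrands)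
    have hd : (B.numStrands : ℝ) ≤ f.totalDegree := by
      exact_mod_cast hf.numStrands_le_totalDegree B
    rw [div_le_iff₀ (by positivity)] at h
    by_contra! hlt
    nlinarith
  refine ⟨fun a b _ _ f hf h => ⟨fun u r t hr => B.p_mul_exp u t hr,
    B.continuous_p (hk a b f hf h) hq₁ hq₂⟩, 1, one_pos, fun a b ha _ hb _ f hf h => ?_⟩
  have h1 := hk a b f hf h
  exact ⟨B.isWeaklyIsolatedSingularPoint_p hs h1 hq₁ hq₂ ha hb, fun ρ hρ hρ1 =>
    B.nodalLink_ambientIsotopic_closure hs h1 hq₁ hq₂ ha hb hρ hρ1⟩
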